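/- **Setting.** Let $V$ be a finite-dimensional real vector space with a symmetric bilinear form $(-\mid-)$ of signature $(n,0,2)$ ($n$ positive, no negative, two zero eigenvalues), $\dim V=n+2$, and radical $R$. For non-isotropic $\alpha$ put $s_\alpha(v)=v-\frac{2(\alpha\mid v)}{(\alpha\mid\alpha)}\alpha$. Let $\Phi\subseteq V$ be a simply-laced elliptic root system: a non-empty set with $(\alpha\mid\alpha)=2$ for all $\alpha\in\Phi$, spanning $V$, with $s_\alpha(\Phi)\subseteq\Phi$ and $\frac{2(\alpha\mid\beta)}{(\beta\mid\beta)}\in\mathbb Z$ for all $\alpha,\beta\in\Phi$, which is reduced ($r\alpha\in\Phi$ with $\alpha\in\Phi$, $r\in\mathbb R$ implies $r=\pm1$) and irreducible (not a union of two mutually orthogonal sets, each a generalized root system in its span). Let $L(\Phi)=\mathrm{span}_{\mathbb Z}(\Phi)$. Let $U\le R$ be a line with $U\cap L(\Phi)\ne\{0\}$, let $L(\Phi)\cap U=\mathbb Z a$, and let $\alpha_0,\dots,\alpha_n\in\Phi$ be roots whose images $\beta_0,\dots,\beta_n$ in $V/U$ form a root basis of the affine root system $\Phi/U$ (the image of $\Phi$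 in $V/U$), such that $\beta_1,\dots,\beta_n$ is a root basis of a finite root system (the set of elements of $\Phi/U$ lying in the real span of $\beta_1,\dots,\beta_n$) and such that $\beta_0+\sum_{i=1}^n m_i\beta_i$ spans the lattice $\mathrm{span}_{\mathbb Z}(\Phi/U)\cap R/U$ for positive integers $m_1,\dots,m_n$. Here a root basis is a linearly independent set of roots such that every root is an integral linear combination of its members with coefficients all $\ge0$ or all $\le 0$. Put $m_0=1$ and $b=\sum_{i=0}^n m_i\alpha_i$. Assume that the system is *tubular*: the maximum of $m_0,\dots,m_n$ is attained at exactly one index $t$. Put $\alpha_{t^*}=\alpha_t+a$ and $B=\{\alpha_0,\dots,\alpha_n,\alpha_{t^*}\}$. The tubular elliptic Weyl system $(W,S)$ is given by $W=\langle s_\alpha\mid\alpha\in\Phi\rangle$ and $S=\{s_\alpha\mid\alpha\in B\}$, with set of reflections $T=\bigcup_{w\in W}wSw^{-1}$. A Coxeter transformation is $c=\bigl(\prod_{i\in\{0,\dots,n\}\setminus\{t\}}s_{\alpha_i}\bigr)s_{\alpha_t}s_{\alpha_{t^*}}$, the first $n$ factors being taken in any fixed order. Let $\hat V\supseteq V$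 be a real vector space with a symmetric bilinear form of signature $(n+2,2,0)$ that extends $(-\mid-)$, let $b'\in\hat V$ be an isotropic vector with $(a\mid b')=0$ and $(b\mid b')\neq0$, and let $\tilde V=V\oplus\mathbb R b'\subseteq\hat V$. For $\alpha\in B$ let $\tilde s_\alpha$ be the reflection of $\tilde V$ with respect to $\alpha$. The hyperbolic cover $(\tilde W,\tilde S)$ of $(W,S)$ is given by $\tilde S=\{\tilde s_\alpha\mid\alpha\in B\}$ and $\tilde W=\langle\tilde S\rangle$; let $\tilde T=\bigcup_{w\in\tilde W}w^{-1}\tilde Sw$, and let $\tilde c$ be the product of the $\tilde s_\alpha$, $\alpha\in B$, in the same order as in $c$. For a generating set $X$ of a group, $\ell_X(w)$ denotes the least number of factors in an expression of $w$ as a product of elements of $X$. **Proposition 1.1.** For every tubular elliptic Weyl system $(W,S)$ with hyperbolic cover $(\tilde W,\tilde S)$ and every Coxeter transformation $c$ with corresponding $\tilde c$, $$\ell_{\tilde T}(\tilde c)=\ell_T(c)\qquad\text{and}\qquad \ell_T(c)=|S|=n+2 .$$ -/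

import Mathlib

open LinearMap (BilinForm)

noncomputable section

namespace Elliptic

section Reflections

variable {V : Type*} [AddCommGroup V] [Module ℝ V]

/-- The linear map `v ↦ v - (2 (α ∣ v) / (α ∣ α)) α`. (For isotropic `α` this is the identity; it is
only ever used for roots, which are non-isotropic.) -/
def reflMap (B : BilinForm ℝ V) (α : V) : V →ₗ[ℝ] V :=
  LinearMap.id - ((2 / B α α) • B α).smulRight α

theorem reflMap_apply (B : BilinForm ℝ V) (α v : V) :
    reflMap B α v = v - (2 * B α v / B α α) • α := by
  simp [reflMap, mul_div_right_comm]

theorem reflMap_involutive (B : BilinForm ℝ V) (α : V) : Function.Involutive (reflMap B α) := by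
  intro v
  by_cases h : B α α = 0
  · simp [reflMap_apply, h]
  · have h2 : 2 * (B α v - 2 * B α v / B α α * B α α) / B α α = -(2 * B α v / B α α) := by
      field_simp
      ring
    rw [reflMap_apply, reflMap_apply, map_sub, map_smul, smul_eq_mul, h2, neg_smul]
    abel

/-- The reflection `s_α` as a linear automorphism. -/
def refl (B : BilinForm ℝ V) (α : V) : V ≃ₗ[ℝ] V :=
  LinearEquiv.ofInvolutive (reflMap B α) (reflMap_involutive B α)

/-- The form `B` has signature `(p, q, r)`: `p` positive, `q` negative and `r` zero eigenvalues. -/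
def HasSignature (B : BilinForm ℝ V) (p q r : ℕ) : Prop :=
  B.IsSymm ∧
  sigPos (LinearMap.BilinMap.toQuadraticMap B) = p ∧
  sigNeg (LinearMap.BilinMap.toQuadraticMap B) = q ∧
  Module.finrank ℝ (LinearMap.ker B) = r

/-- `Ψ` is a generalized root system in the subspace which it spans. -/
structure IsRootSystemInSpan (B : BilinForm ℝ V) (Ψ : Set V) : Prop where
  nonempty : Ψ.Nonempty
  nonisotropic : ∀ α ∈ Ψ, B α α ≠ 0
  refl_mem : ∀ α ∈ Ψ, ∀ β ∈ Ψ, refl B α β ∈ Ψ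
  crystallographic : ∀ α ∈ Ψ, ∀ β ∈ Ψ, ∃ k : ℤ, 2 * B α β / B β β = k

/-- `Φ` is a generalized root system in `V`. -/
structure IsGeneralizedRootSystem (B : BilinForm ℝ V) (Φ : Set V) : Prop
    extends IsRootSystemInSpan B Φ where
  span_eq_top : Submodule.span ℝ Φ = ⊤

def IsReduced (Φ : Set V) : Prop :=
  ∀ α ∈ Φ, ∀ r : ℝ, r • α ∈ Φ → r = 1 ∨ r = -1

def IsIrreducible (B : BilinForm ℝ V) (Φ : Set V) : Prop :=
  ¬ ∃ Φ₁ Φ₂ : Set V, IsRootSystemInSpan B Φ₁ ∧ IsRootSystemInSpan B Φ₂ ∧ Φ = Φ₁ ∪ Φ₂ ∧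
    ∀ x ∈ Φ₁, ∀ y ∈ Φ₂, B x y = 0

/-- `Φ` is an elliptic root system in the space `V` of dimension `n + 2`. -/
structure IsEllipticRootSystem (B : BilinForm ℝ V) (n : ℕ) (Φ : Set V) : Prop
    extends IsGeneralizedRootSystem B Φ where
  irreducible : IsIrreducible B Φ
  reduced : IsReduced Φ
  finrank_eq : Module.finrank ℝ V = n + 2
  signature : HasSignature B n 0 2

def IsSimplyLaced (B : BilinForm ℝ V) (Φ : Set V) : Prop :=
  ∀ α ∈ Φ, B α α = 2

/-- The root lattice `L(Φ)`. -/
def rootLattice (Φ : Set V) : Submodule ℤ V := Submodule.span ℤ Φ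

/-- `β` is a root basis of `Φ`: its members are linearly independent roots, and each root is
an integral linear combination of them with all coefficients `≥ 0` or all coefficients `≤ 0`. -/
structure IsRootBasis {ι : Type*} [Fintype ι] (Φ : Set V) (β : ι → V) : Prop where
  mem : ∀ i, β i ∈ Φ
  linearIndependent : LinearIndependent ℝ β
  coeff : ∀ φ ∈ Φ, ∃ z : ι → ℤ, φ = ∑ i, z i • β i ∧ ((∀ i, 0 ≤ z i) ∨ (∀ i, z i ≤ 0))

end Reflections

section EllipticBasis

variable {V : Type*} [AddCommGroup V] [Module ℝ V]

/-- The choices that define an elliptic root basis of `Φ`: a line `U` in the radical `R` which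
meets the root lattice, a generator `a` of `L(Φ) ∩ U`, and roots `α₀, …, αₙ` of `Φ` whose classes
`βᵢ` form a root basis of the affine root system `Φ / U` in `V / U`, such that `β₁, …, βₙ` is a
root basis of a finite root system and `β₀ + m₁ β₁ + ⋯ + mₙ βₙ` spans the lattice
`L(Φ / U) ∩ R / U`, where `m₁, …, mₙ` are positive integers; `m₀ = 1`. -/
structure EllipticBasisData (B : BilinForm ℝ V) (Φ : Set V) (n : ℕ) where
  U : Submodule ℝ V
  U_le : U ≤ LinearMap.ker B
  finrank_U : Module.finrank ℝ U = 1
  U_meets : ∃ x ∈ U, x ∈ rootLattice Φ ∧ x ≠ 0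
  a : V
  a_spans : rootLattice Φ ⊓ U.restrictScalars ℤ = Submodule.span ℤ {a}
  α : Fin (n + 1) → V
  α_mem : ∀ i, α i ∈ Φ
  basis_aff : IsRootBasis (U.mkQ '' Φ) (fun i => U.mkQ (α i))
  finite_fin : {ψ | ψ ∈ U.mkQ '' Φ ∧
    ψ ∈ Submodule.span ℝ (Set.range fun i : Fin n => U.mkQ (α i.succ))}.Finite
  basis_fin : IsRootBasis {ψ | ψ ∈ U.mkQ '' Φ ∧
    ψ ∈ Submodule.span ℝ (Set.range fun i : Fin n => U.mkQ (α i.succ))}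
    (fun i : Fin n => U.mkQ (α i.succ))
  m : Fin (n + 1) → ℕ
  m_zero : m 0 = 1
  m_pos : ∀ i, 0 < m i
  m_spans : rootLattice (U.mkQ '' Φ) ⊓ ((LinearMap.ker B).map U.mkQ).restrictScalars ℤ =
    Submodule.span ℤ {∑ i, m i • U.mkQ (α i)}

namespace EllipticBasisData

variable {B : BilinForm ℝ V} {Φ : Set V} {n : ℕ} (D : EllipticBasisData B Φ n)

def b : V := ∑ i, D.m i • D.α i

def mMax : ℕ := Finset.univ.sup D.m

/-- `B_max = {αᵢ + a ∣ mᵢ = m_max}`. -/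
def basisMax : Set V := {x | ∃ i, D.m i = D.mMax ∧ x = D.α i + D.a}

/-- The elliptic root basis `{α₀, …, αₙ} ∪ B_max`. -/
def rootBasis : Set V := Set.range D.α ∪ D.basisMax

def IsTubular : Prop := D.basisMax.ncard = 1

/-- The product, for a map `r` from `V` to a group, of the `r (αᵢ)` for `i` in the list `l`,
followed by `r (αₜ)` and `r (αₜ + a)`. -/
def coxeterProd {G : Type*} [Group G] (r : V → G) (l : List (Fin (n + 1))) (t : Fin (n + 1)) : G :=
  (l.map fun i => r (D.α i)).prod * (r (D.α t) * r (D.α t + D.a))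

/-- The simple system `S` of the elliptic Weyl system. -/
def S : Set (V ≃ₗ[ℝ] V) := refl B '' D.rootBasis

/-- A Coxeter transformation `c` in `W`; `l` is the order of the first `n` factors. -/
def c (l : List (Fin (n + 1))) (t : Fin (n + 1)) : V ≃ₗ[ℝ] V :=
  D.coxeterProd (refl B) l t

end EllipticBasisData

/-- The elliptic Weyl group `W = W_Φ`. -/
def weylGroup (B : BilinForm ℝ V) (Φ : Set V) : Subgroup (V ≃ₗ[ℝ] V) :=
  Subgroup.closure (refl B '' Φ)

end EllipticBasis

section Length

variable {G : Type*} [Group G]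

/-- The set of all conjugates of elements of `S` by elements of the subgroup `W`. -/
def reflSet (W : Subgroup G) (S : Set G) : Set G :=
  {x | ∃ w ∈ W, ∃ s ∈ S, x = w * s * w⁻¹}

/-- `ℓ_T(w)`: the least number of factors in an expression of `w` as a product of elements
of `T`. -/
def reflLength (T : Set G) (w : G) : ℕ :=
  sInf {k | ∃ l : List G, l.length = k ∧ (∀ x ∈ l, x ∈ T) ∧ l.prod = w}

end Length

section Hyperbolic

variable {V : Type*} [AddCommGroup V] [Module ℝ V] {B : BilinForm ℝ V} {Φ : Set V} {n : ℕ}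
variable {Vh : Type*} [AddCommGroup Vh] [Module ℝ Vh]

/-- A hyperbolic extended space of `V`: the space `Vh` with the form `Bh` of signature
`(n + 2, 2, 0)`, an isometric embedding of `V` into `Vh`, and an isotropic vector `b'` of `Vh`
which is orthogonal to `a` and spans together with `b` a hyperbolic plane. -/
structure HyperbolicExtension (D : EllipticBasisData B Φ n) (Bh : BilinForm ℝ Vh) where
  signature : HasSignature Bh (n + 2) 2 0
  emb : V →ₗ[ℝ] Vh
  emb_injective : Function.Injective emb
  emb_isometry : ∀ v w, Bh (emb v) (emb w) = B v w
  b' : Vh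
  b'_isotropic : Bh b' b' = 0
  a_b' : Bh (emb D.a) b' = 0
  b_b' : Bh (emb D.b) b' ≠ 0

namespace HyperbolicExtension

variable {D : EllipticBasisData B Φ n} {Bh : BilinForm ℝ Vh} (H : HyperbolicExtension D Bh)

/-- The subspace `Ṽ = V ⊕ ⟨b'⟩` of `Vh`. -/
def Vt : Submodule ℝ Vh := LinearMap.range H.emb ⊔ Submodule.span ℝ {H.b'}

/-- The embedding of `V` into `Ṽ`. -/
def incl : V →ₗ[ℝ] H.Vt :=
  H.emb.codRestrict H.Vt fun v =>
    Submodule.mem_sup_left (LinearMap.mem_range_self H.emb v)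

/-- The reflection `s̃_α` of `Ṽ`, for `α` in `V`. -/
def reflT (α : V) : H.Vt ≃ₗ[ℝ] H.Vt := refl (Bh.restrict H.Vt) (H.incl α)

/-- The simple system `S̃`. -/
def St : Set (H.Vt ≃ₗ[ℝ] H.Vt) := H.reflT '' D.rootBasis

/-- The hyperbolic cover `W̃`, generated by `S̃`. -/
def Wt : Subgroup (H.Vt ≃ₗ[ℝ] H.Vt) := Subgroup.closure H.St

/-- The Coxeter transformation `c̃` in `W̃`. -/
def ct (l : List (Fin (n + 1))) (t : Fin (n + 1)) : H.Vt ≃ₗ[ℝ] H.Vt :=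
  D.coxeterProd H.reflT l t

end HyperbolicExtension

end Hyperbolic

end Elliptic

end

noncomputable section

namespace Elliptic

/-! ### Reflections: isometry, conjugation, determinant. -/

section Reflections

variable {V : Type*} [AddCommGroup V] [Module ℝ V] {B : BilinForm ℝ V}

/-! Both `c` and `c̃` are products of n + 2 reflections in linearly independent roots, so their
fixed vectors are orthogonal to all these roots and lie in the radical R, of dimension 2
(`orthogonal_of_reflProd_eq`). A product of k reflections fixes a subspace of codimension at most k
and has determinant (-1)^k. On Ṽ, of dimension n + 3, this gives k ≥ n + 1, and parity improves it
to n + 2.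

On V the same count gives only k ≥ n; parity excludes n + 1, and length n is excluded by arithmetic
(`lt_of_reflProd_eq_c`). Suppose c is the product of the reflections in γ₁, …, γₙ. For dimension
reasons the coefficients in v - cv = ∑ yᵢ(v) γᵢ can be prescribed, so γᵢ = uᵢ - c uᵢ for some uᵢ.
The last two factors of c compose to v ↦ v - (αₜ|v) a, so v - cv is a combination of the αⱼ with j ≠
t plus (αₜ|v) a (`exists_sub_c`). Hence each γᵢ is an integral combination of these αⱼ modulo R, and
(αₜ|uᵢ) is an integer (`exists_int_of_sub_c_mem`). So (αₜ|·) = ∑ (αₜ|uᵢ) yᵢ is an integral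
combination of the forms (γⱼ|·), which puts αₜ in the integral span of the other αⱼ modulo R. Since
R is spanned by a and b = ∑ mᵢ αᵢ, this makes mₜ divide every mⱼ, contradicting strict maximality of
mₜ (`α_notMem_span`). -/

theorem refl_apply (B : BilinForm ℝ V) (γ v : V) :
    refl B γ v = v - (2 * B γ v / B γ γ) • γ :=
  reflMap_apply B γ v

theorem refl_apply_of_sq_eq_two {γ : V} (hγ : B γ γ = 2) (v : V) :
    refl B γ v = v - B γ v • γ := by
  rw [refl_apply, hγ, mul_div_cancel_left₀ _ two_ne_zero]

theorem refl_isometry (hB : B.IsSymm) (γ v w : V) :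
    B (refl B γ v) (refl B γ w) = B v w := by
  by_cases h : B γ γ = 0
  · simp [refl_apply, h]
  · have hs : B v γ = B γ v := hB.eq v γ
    simp only [refl_apply, map_sub, map_smul, LinearMap.sub_apply, LinearMap.smul_apply,
      smul_eq_mul, hs]
    field_simp
    ring

theorem isometry_of_mem_closure (hB : B.IsSymm) {X : Set V} {w : V ≃ₗ[ℝ] V}
    (hw : w ∈ Subgroup.closure (refl B '' X)) : ∀ u v, B (w u) (w v) = B u v := by
  induction hw using Subgroup.closure_induction with
  | mem x hx =>
    obtain ⟨γ, -, rfl⟩ := hx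
    exact refl_isometry hB γ
  | one => intro u v; rfl
  | mul x y _ _ hx hy =>
    intro u v
    rw [LinearEquiv.mul_apply, LinearEquiv.mul_apply, hx, hy]
  | inv x _ hx =>
    intro u v
    rw [← hx, ← LinearEquiv.mul_apply, ← LinearEquiv.mul_apply, mul_inv_cancel]
    rfl

theorem refl_inv (B : BilinForm ℝ V) (γ : V) : (refl B γ)⁻¹ = refl B γ := by
  refine inv_eq_of_mul_eq_one_left (LinearEquiv.ext fun v => ?_)
  exact reflMap_involutive B γ v

theorem map_mem_of_mem_weylGroup {Φ : Set V} (hΦ : ∀ α ∈ Φ, ∀ β ∈ Φ, refl B α β ∈ Φ)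
    {w : V ≃ₗ[ℝ] V} (hw : w ∈ weylGroup B Φ) : ∀ β ∈ Φ, w β ∈ Φ := by
  induction hw using Subgroup.closure_induction'' with
  | mem x hx =>
    obtain ⟨γ, hγ, rfl⟩ := hx
    exact hΦ γ hγ
  | inv_mem x hx =>
    obtain ⟨γ, hγ, rfl⟩ := hx
    rw [refl_inv]
    exact hΦ γ hγ
  | one => exact fun β hβ => hβ
  | mul x y _ _ hx hy => exact fun β hβ => hx _ (hy _ hβ)

theorem apply_eq_of_mem_ker {Φ : Set V} {w : V ≃ₗ[ℝ] V} (hw : w ∈ weylGroup B Φ) {r : V}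
    (hB : B.IsSymm) (hr : r ∈ LinearMap.ker B) : w r = r := by
  have hr' : ∀ γ, refl B γ r = r := fun γ => by
    have h : B γ r = 0 := by rw [← hB.eq, LinearMap.mem_ker.1 hr]; rfl
    rw [refl_apply, h]
    simp
  induction hw using Subgroup.closure_induction'' with
  | mem x hx =>
    obtain ⟨γ, -, rfl⟩ := hx
    exact hr' γ
  | inv_mem x hx =>
    obtain ⟨γ, -, rfl⟩ := hx
    rw [refl_inv]
    exact hr' γ
  | one => rfl
  | mul x y _ _ hx hy => rw [LinearEquiv.mul_apply, hy, hx]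

theorem conj_refl {w : V ≃ₗ[ℝ] V} (hw : ∀ u v, B (w u) (w v) = B u v) (γ : V) :
    w * refl B γ * w⁻¹ = refl B (w γ) := by
  ext v
  have h : B (w γ) v = B γ (w⁻¹ v) := by
    rw [← hw γ, ← LinearEquiv.mul_apply, mul_inv_cancel]; rfl
  have h' : w (w⁻¹ v) = v := by
    rw [← LinearEquiv.mul_apply, mul_inv_cancel]; rfl
  rw [LinearEquiv.mul_apply, LinearEquiv.mul_apply, refl_apply, refl_apply, map_sub, map_smul, h',
    hw, h]

/-- Evaluating both reflections at γ gives 2γ = (δ|γ) δ. -/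
theorem exists_eq_smul_of_refl_eq {γ δ : V} (hγ : B γ γ = 2) (hδ : B δ δ = 2)
    (h : refl B γ = refl B δ) : ∃ r : ℝ, γ = r • δ := by
  have h1 := LinearEquiv.congr_fun h γ
  rw [refl_apply_of_sq_eq_two hγ, refl_apply_of_sq_eq_two hδ, hγ, sub_right_inj] at h1
  refine ⟨B δ γ / 2, ?_⟩
  rw [div_eq_inv_mul, mul_smul, ← h1, smul_smul, inv_mul_cancel₀ two_ne_zero, one_smul]

theorem det_refl [FiniteDimensional ℝ V] {γ : V} (hγ : B γ γ = 2) :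
    LinearEquiv.det (refl B γ) = -1 := by
  apply Units.ext
  -- The map v ↦ v + f(v) γ has determinant 1 + f(γ), here 1 - 2.
  have h : ((refl B γ : V ≃ₗ[ℝ] V) : V →ₗ[ℝ] V) = LinearMap.transvection (-(B γ)) γ := by
    ext v
    simp [refl_apply_of_sq_eq_two hγ, LinearMap.transvection, sub_eq_add_neg]
  rw [LinearEquiv.coe_det, h, LinearMap.transvection.det]
  simp [hγ]
  norm_num

theorem det_list_prod [FiniteDimensional ℝ V] {l : List (V ≃ₗ[ℝ] V)}
    (hl : ∀ x ∈ l, ∃ γ, B γ γ = 2 ∧ x = refl B γ) :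
    LinearEquiv.det l.prod = (-1) ^ l.length := by
  induction l with
  | nil => simp
  | cons x l ih =>
    obtain ⟨γ, hγ, rfl⟩ := hl x (by simp)
    rw [List.prod_cons, map_mul, det_refl hγ, ih fun y hy => hl y (by simp [hy]),
      List.length_cons, pow_succ']

/-! ### Products of reflections: moved vectors, fixed vectors, parity. -/

/-- The product of the reflections in `γ 0, …, γ (k - 1)`. -/
def reflProd (B : BilinForm ℝ V) {k : ℕ} (γ : Fin k → V) : V ≃ₗ[ℝ] V :=
  (List.ofFn fun i => refl B (γ i)).prod

theorem reflProd_succ {k : ℕ} (γ : Fin (k + 1) → V) :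
    reflProd B γ = refl B (γ 0) * reflProd B fun i : Fin k => γ i.succ := by
  simp [reflProd, List.ofFn_succ]

theorem sub_reflProd_mem_span {k : ℕ} (γ : Fin k → V) (hγ : ∀ i, B (γ i) (γ i) = 2) (v : V) :
    v - reflProd B γ v ∈ Submodule.span ℝ (Set.range γ) := by
  induction k with
  | zero => simp [reflProd]
  | succ k ih =>
    rw [reflProd_succ, LinearEquiv.mul_apply, refl_apply_of_sq_eq_two (hγ 0), ← sub_add]
    refine add_mem (Submodule.span_mono ?_ (ih (fun i => γ i.succ) fun i => hγ _))
      (Submodule.smul_mem _ _ (Submodule.subset_span ⟨0, rfl⟩))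
    rintro _ ⟨i, rfl⟩
    exact ⟨i.succ, rfl⟩

/-- A product of reflections in linearly independent vectors fixes only the vectors which are
orthogonal to all of them. -/
theorem orthogonal_of_reflProd_eq {k : ℕ} (γ : Fin k → V) (hγ : ∀ i, B (γ i) (γ i) = 2)
    (hli : LinearIndependent ℝ γ) {v : V} (hv : reflProd B γ v = v) : ∀ i, B (γ i) v = 0 := by
  induction k with
  | zero => exact fun i => i.elim0
  | succ k ih =>
    obtain ⟨hli', h0⟩ := linearIndependent_finSucc.1 hli
    have hmem := sub_reflProd_mem_span (fun i : Fin k => γ i.succ) (fun i => hγ _) v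
    rw [reflProd_succ, LinearEquiv.mul_apply, refl_apply_of_sq_eq_two (hγ 0)] at hv
    set u := reflProd B (fun i : Fin k => γ i.succ) v with hu
    have hs : v - u = -(B (γ 0) u • γ 0) := by
      nth_rw 1 [← hv]; abel
    -- `v - u` is a multiple of `γ 0` and also lies in the span of the later γ's, so by independence
    -- the multiple is zero.
    have hz : B (γ 0) u = 0 := by
      by_contra hne
      rw [hs, neg_mem_iff, Submodule.smul_mem_iff _ hne] at hmem
      exact h0 hmem
    have huv : u = v := by
      rw [hz, zero_smul, neg_zero, sub_eq_zero] at hs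
      exact hs.symm
    intro i
    refine Fin.cases ?_ (fun j => ?_) i
    · rw [← huv, hz]
    · exact ih (fun i => γ i.succ) (fun i => hγ _) hli' huv j

/-- The coefficients in `v - s₁ ⋯ sₖ v = ∑ yᵢ(v) γᵢ` are integral combinations of the forms
`B γⱼ`. -/
theorem exists_coeff_sub_reflProd {k : ℕ} (γ : Fin k → V) (hγ : ∀ i, B (γ i) (γ i) = 2)
    (hint : ∀ i j, ∃ z : ℤ, B (γ i) (γ j) = z) :
    ∃ y : Fin k → Module.Dual ℝ V, (∀ v, v - reflProd B γ v = ∑ i, y i v • γ i) ∧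
      ∀ i, y i ∈ Submodule.span ℤ (Set.range fun j => B (γ j)) := by
  induction k with
  | zero => exact ⟨fun i => i.elim0, by simp [reflProd], fun i => i.elim0⟩
  | succ k ih =>
    obtain ⟨y, hy, hyz⟩ := ih (fun i => γ i.succ) (fun i => hγ _) fun i j => hint _ _
    have hyz' : ∀ i, y i ∈ Submodule.span ℤ (Set.range fun j => B (γ j)) := by
      intro i
      refine Submodule.span_mono ?_ (hyz i)
      rintro _ ⟨j, rfl⟩
      exact ⟨j.succ, rfl⟩
    have hP : ∀ v, reflProd B (fun i : Fin k => γ i.succ) v = v - ∑ i, y i v • γ i.succ := by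
      intro v; rw [← hy v, sub_sub_cancel]
    -- The new coefficient is (γ₀|Pv), where P is the product of the later reflections and Pv = v -
    -- ∑ yᵢ(v) γᵢ₊₁.
    refine ⟨Fin.cons (B (γ 0) - ∑ i, B (γ 0) (γ i.succ) • y i) y, fun v => ?_, fun i => ?_⟩
    · rw [reflProd_succ, LinearEquiv.mul_apply, refl_apply_of_sq_eq_two (hγ 0), hP, ← sub_add,
        sub_sub_cancel, Fin.sum_univ_succ, add_comm]
      simp [map_sum, mul_comm]
    · refine Fin.cases ?_ (fun j => ?_) i
      · rw [Fin.cons_zero]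
        refine sub_mem (Submodule.subset_span ⟨0, rfl⟩) (sum_mem fun i _ => ?_)
        obtain ⟨z, hz⟩ := hint 0 i.succ
        rw [hz, Int.cast_smul_eq_zsmul ℝ z (y i)]
        exact Submodule.smul_mem _ _ (hyz' i)
      · simpa using hyz' j

/-- The intersection of the k hyperplanes orthogonal to the γ's is fixed pointwise, hence lies in F,
and has codimension at most k. -/
theorem le_finrank_fixed [FiniteDimensional ℝ V] {k : ℕ} (γ : Fin k → V) (F : Submodule ℝ V)
    (hF : ∀ v, reflProd B γ v = v → v ∈ F) :
    Module.finrank ℝ V ≤ k + Module.finrank ℝ F := by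
  have hk : LinearMap.ker (LinearMap.pi fun i => B (γ i)) ≤ F := by
    intro v hv
    have hv' : ∀ i, B (γ i) v = 0 := fun i => congrFun hv i
    refine hF v ?_
    clear hv hF
    induction k with
    | zero => simp [reflProd]
    | succ k ih =>
      rw [reflProd_succ, LinearEquiv.mul_apply, ih (fun i => γ i.succ) fun i => hv' _, refl_apply,
        hv' 0]
      simp
  have h1 := LinearMap.finrank_range_add_finrank_ker (LinearMap.pi fun i => B (γ i))
  have h2 := Submodule.finrank_mono hk
  have h3 := Submodule.finrank_le (LinearMap.range (LinearMap.pi fun i => B (γ i)))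
  rw [Module.finrank_fin_fun] at h3
  omega

theorem exists_reflProd_eq {l : List (V ≃ₗ[ℝ] V)} {P : V → Prop}
    (hl : ∀ x ∈ l, ∃ γ, P γ ∧ x = refl B γ) :
    ∃ γ : Fin l.length → V, (∀ i, P (γ i)) ∧ l.prod = reflProd B γ := by
  choose γ hγ hx using fun i : Fin l.length => hl (l.get i) (List.get_mem _ _)
  refine ⟨γ, hγ, ?_⟩
  simp only [reflProd, ← hx, List.ofFn_get]

theorem length_mod_two_eq [FiniteDimensional ℝ V] {l l' : List (V ≃ₗ[ℝ] V)}
    (hl : ∀ x ∈ l, ∃ γ, B γ γ = 2 ∧ x = refl B γ) (hl' : ∀ x ∈ l', ∃ γ, B γ γ = 2 ∧ x = refl B γ)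
    (h : l.prod = l'.prod) : l.length % 2 = l'.length % 2 := by
  have h1 := congrArg LinearEquiv.det h
  rw [det_list_prod hl, det_list_prod hl'] at h1
  rcases Nat.even_or_odd l.length with e | e <;> rcases Nat.even_or_odd l'.length with e' | e'
  · rw [Nat.even_iff.1 e, Nat.even_iff.1 e']
  · rw [e.neg_one_pow, e'.neg_one_pow] at h1
    have := congrArg Units.val h1
    norm_num at this
  · rw [e.neg_one_pow, e'.neg_one_pow] at h1
    have := congrArg Units.val h1
    norm_num at this
  · rw [Nat.odd_iff.1 e, Nat.odd_iff.1 e']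

end Reflections

/-! ### Word length and integrality of the form on roots. -/

theorem reflLength_eq {G : Type*} [Group G] {T : Set G} {w : G} {l : List G}
    (hl : ∀ x ∈ l, x ∈ T) (hw : l.prod = w)
    (h : ∀ l' : List G, (∀ x ∈ l', x ∈ T) → l'.prod = w → l.length ≤ l'.length) :
    reflLength T w = l.length := by
  refine le_antisymm (Nat.sInf_le ⟨l, rfl, hl, hw⟩) (le_csInf ⟨_, l, rfl, hl, hw⟩ ?_)
  rintro _ ⟨l', rfl, h1, h2⟩
  exact h l' h1 h2

theorem IsSimplyLaced.exists_int {V : Type*} [AddCommGroup V] [Module ℝ V] {B : BilinForm ℝ V}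
    {Φ : Set V} (hsl : IsSimplyLaced B Φ)
    (hΦ : IsRootSystemInSpan B Φ) {γ δ : V} (hγ : γ ∈ Φ) (hδ : δ ∈ Φ) : ∃ z : ℤ, B γ δ = z := by
  obtain ⟨z, hz⟩ := hΦ.crystallographic γ hγ δ hδ
  rw [hsl δ hδ, mul_div_cancel_left₀ _ two_ne_zero] at hz
  exact ⟨z, hz⟩

/-! ### The elliptic root basis and its simple reflections. -/

namespace EllipticBasisData

variable {V : Type*} [AddCommGroup V] [Module ℝ V] {B : BilinForm ℝ V} {Φ : Set V} {n : ℕ}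
  (D : EllipticBasisData B Φ n)

theorem mem_span_a_iff (x : V) : x ∈ rootLattice Φ ∧ x ∈ D.U ↔ ∃ k : ℤ, k • D.a = x := by
  rw [← Submodule.mem_span_singleton, ← D.a_spans]
  rfl

theorem a_mem : D.a ∈ D.U := ((D.mem_span_a_iff D.a).2 ⟨1, one_smul _ _⟩).2

theorem a_mem_ker : D.a ∈ LinearMap.ker B := D.U_le D.a_mem

theorem a_ne_zero : D.a ≠ 0 := by
  intro h
  obtain ⟨x, hxU, hxL, hx⟩ := D.U_meets
  obtain ⟨k, hk⟩ := (D.mem_span_a_iff x).1 ⟨hxL, hxU⟩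
  rw [h, smul_zero] at hk
  exact hx hk.symm

theorem mkQ_b : D.U.mkQ D.b = ∑ i, D.m i • D.U.mkQ (D.α i) := by
  simp [b, map_sum, map_nsmul]

theorem mem_ker_of_mkQ_mem {v : V} (hv : D.U.mkQ v ∈ (LinearMap.ker B).map D.U.mkQ) :
    v ∈ LinearMap.ker B := by
  obtain ⟨r, hr, hrv⟩ := hv
  have h : r - v ∈ D.U := (Submodule.Quotient.eq D.U).1 hrv
  have := sub_mem hr (D.U_le h)
  rwa [sub_sub_cancel] at this

theorem b_mem_ker : D.b ∈ LinearMap.ker B := by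
  have h : (∑ i, D.m i • D.U.mkQ (D.α i)) ∈
      rootLattice (D.U.mkQ '' Φ) ⊓ ((LinearMap.ker B).map D.U.mkQ).restrictScalars ℤ := by
    rw [D.m_spans]
    exact Submodule.mem_span_singleton_self _
  refine D.mem_ker_of_mkQ_mem ?_
  rw [mkQ_b]
  exact h.2

theorem sum_smul_mem_U_iff {x : Fin (n + 1) → ℝ} :
    ∑ i, x i • D.α i ∈ D.U ↔ x = 0 := by
  constructor
  · intro h
    have h0 : ∑ i, x i • D.U.mkQ (D.α i) = 0 := by
      rw [← Submodule.ker_mkQ D.U, LinearMap.mem_ker] at h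
      simpa [map_sum] using h
    exact funext (Fintype.linearIndependent_iff.1 D.basis_aff.linearIndependent x h0)
  · rintro rfl
    simp

theorem linearIndependent_α : LinearIndependent ℝ D.α :=
  LinearIndependent.of_comp D.U.mkQ D.basis_aff.linearIndependent

/-- The family `α₀, …, αₙ` together with `αₜ + a`. -/
def extBasis (t : Fin (n + 1)) (o : Option (Fin (n + 1))) : V := o.elim (D.α t + D.a) D.α

theorem linearIndependent_extBasis (t : Fin (n + 1)) : LinearIndependent ℝ (D.extBasis t) := by
  refine linearIndependent_option.2 ⟨D.linearIndependent_α, fun h => ?_⟩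
  obtain ⟨x, hx⟩ := (Submodule.mem_span_range_iff_exists_fun ℝ).1 h
  have hx' : ∑ i, x i • D.α i = D.α t + D.a := hx
  have h1 : ∑ i, (x - Pi.single t 1 : Fin (n + 1) → ℝ) i • D.α i = D.a := by
    simp [sub_smul, Finset.sum_sub_distrib, hx', Pi.single_apply, ite_smul]
  have h2 := D.sum_smul_mem_U_iff.1 (h1 ▸ D.a_mem)
  rw [h2] at h1
  exact D.a_ne_zero (by simpa using h1.symm)

theorem rootBasis_eq (hD : D.IsTubular) {t : Fin (n + 1)} (ht : D.m t = D.mMax) :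
    D.rootBasis = Set.range (D.extBasis t) := by
  obtain ⟨x, hx⟩ := Set.ncard_eq_one.1 hD
  have h : D.α t + D.a ∈ D.basisMax := ⟨t, ht, rfl⟩
  have h' : D.α t + D.a = x := by rwa [hx] at h
  rw [rootBasis, hx, ← h']
  ext v
  simp [extBasis, Option.exists, eq_comm]

/-- A second index attaining the maximum would give a second element of `basisMax`, because `α` is
injective. -/
theorem m_lt (hD : D.IsTubular) {t : Fin (n + 1)} (ht : D.m t = D.mMax) {i : Fin (n + 1)}
    (hi : i ≠ t) : D.m i < D.m t := by
  refine lt_of_le_of_ne (ht ▸ Finset.le_sup (Finset.mem_univ i)) fun h => hi ?_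
  obtain ⟨x, hx⟩ := Set.ncard_eq_one.1 hD
  have h1 : D.α t + D.a ∈ D.basisMax := ⟨t, ht, rfl⟩
  have h2 : D.α i + D.a ∈ D.basisMax := ⟨i, h.trans ht, rfl⟩
  rw [hx] at h1 h2
  exact D.linearIndependent_α.injective (add_right_cancel (h2.trans h1.symm))

theorem extBasis_sq (hB : B.IsSymm) (hsl : IsSimplyLaced B Φ) (t : Fin (n + 1))
    (o : Option (Fin (n + 1))) : B (D.extBasis t o) (D.extBasis t o) = 2 := by
  have h1 : B D.a = 0 := D.a_mem_ker
  have h2 : B (D.α t) D.a = 0 := by rw [← hB.eq]; simp [h1]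
  cases o with
  | none => simp [extBasis, h1, h2, hsl _ (D.α_mem t)]
  | some i => exact hsl _ (D.α_mem i)

theorem card_S (hB : B.IsSymm) (hsl : IsSimplyLaced B Φ) (hD : D.IsTubular) {t : Fin (n + 1)}
    (ht : D.m t = D.mMax) : D.S.ncard = n + 2 := by
  have hinj : Function.Injective fun o => refl B (D.extBasis t o) := by
    intro o o' h
    obtain ⟨r, hr⟩ := exists_eq_smul_of_refl_eq (D.extBasis_sq hB hsl t o)
      (D.extBasis_sq hB hsl t o') h
    by_contra hne
    refine (D.linearIndependent_extBasis t).notMem_span_image (s := {o'}) (x := o) hne ?_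
    rw [Set.image_singleton, hr]
    exact Submodule.smul_mem _ _ (Submodule.mem_span_singleton_self _)
  rw [S, D.rootBasis_eq hD ht, ← Set.range_comp, ← Set.image_univ,
    Set.ncard_image_of_injective (f := refl B ∘ D.extBasis t) _ hinj, Set.ncard_univ, Nat.card_eq_fintype_card, Fintype.card_option, Fintype.card_fin]

/-- The order of the indices of the simple reflections in a Coxeter transformation. -/
def extList (l : List (Fin (n + 1))) (t : Fin (n + 1)) : List (Option (Fin (n + 1))) :=
  l.map some ++ [some t, none]

theorem coxeterProd_eq {G : Type*} [Group G] (r : V → G) (l : List (Fin (n + 1)))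
    (t : Fin (n + 1)) :
    D.coxeterProd r l t = ((extList l t).map fun o => r (D.extBasis t o)).prod := by
  simp [coxeterProd, extList, extBasis, Function.comp_def]

theorem nodup_extList {l : List (Fin (n + 1))} {t : Fin (n + 1)} (hl : l.Nodup)
    (hlt : ∀ i, i ∈ l ↔ i ≠ t) : (extList l t).Nodup := by
  rw [extList, List.nodup_append]
  refine ⟨hl.map (Option.some_injective _), by simp, ?_⟩
  simp [hlt]

theorem mem_extList {l : List (Fin (n + 1))} {t : Fin (n + 1)}
    (hlt : ∀ i, i ∈ l ↔ i ≠ t) (o : Option (Fin (n + 1))) : o ∈ extList l t := by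
  cases o with
  | none => simp [extList]
  | some i => simp [extList, hlt, em']

theorem length_extList {l : List (Fin (n + 1))} {t : Fin (n + 1)} (hl : l.Nodup)
    (hlt : ∀ i, i ∈ l ↔ i ≠ t) : (extList l t).length = n + 2 := by
  have h := List.toFinset_card_of_nodup (nodup_extList hl hlt)
  rw [← h, Finset.eq_univ_of_forall fun o => List.mem_toFinset.2 (mem_extList hlt o),
    Finset.card_univ, Fintype.card_option, Fintype.card_fin]

end EllipticBasisData

/-! ### Arithmetic modulo the radical and the length of `c`. -/

namespace EllipticBasisData

variable {V : Type*} [AddCommGroup V] [Module ℝ V] {B : BilinForm ℝ V} {Φ : Set V} {n : ℕ}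
  (D : EllipticBasisData B Φ n)

/-- U is a line in the plane R, and b ∈ R lies outside U because its coefficient m₀ = 1 does not
vanish modulo U. -/
theorem ker_le [FiniteDimensional ℝ V] (hR : Module.finrank ℝ (LinearMap.ker B) = 2) :
    LinearMap.ker B ≤ D.U ⊔ Submodule.span ℝ {D.b} := by
  have hle : D.U ⊔ Submodule.span ℝ {D.b} ≤ LinearMap.ker B :=
    sup_le D.U_le ((Submodule.span_singleton_le_iff_mem _ _).2 D.b_mem_ker)
  have hb : D.b ∉ D.U := by
    intro h
    have h1 : ∑ i, (fun i => (D.m i : ℝ)) i • D.α i ∈ D.U := by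
      simpa only [Nat.cast_smul_eq_nsmul, b] using h
    have h2 := congrFun (D.sum_smul_mem_U_iff.1 h1) 0
    simp [D.m_zero] at h2
  have hlt : D.U < D.U ⊔ Submodule.span ℝ {D.b} := by
    rwa [left_lt_sup, Submodule.span_singleton_le_iff_mem]
  have h1 := Submodule.finrank_lt_finrank_of_lt hlt
  rw [D.finrank_U] at h1
  exact (Submodule.eq_of_le_of_finrank_le hle (by omega)).ge

theorem exists_sub_prod_refl {t : Fin (n + 1)} {l : List (Fin (n + 1))} (hl : ∀ i ∈ l, i ≠ t)
    (v : V) : ∃ x : Fin (n + 1) → ℝ, x t = 0 ∧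
      v - (l.map fun i => refl B (D.α i)).prod v = ∑ i, x i • D.α i := by
  induction l with
  | nil => exact ⟨0, rfl, by simp⟩
  | cons j l ih =>
    obtain ⟨x, hx, hv⟩ := ih fun i hi => hl i (by simp [hi])
    set u := (l.map fun i => refl B (D.α i)).prod v with hu
    refine ⟨x + Pi.single j (2 * B (D.α j) u / B (D.α j) (D.α j)), ?_, ?_⟩
    · simp [hx, (hl j (by simp)).symm]
    · rw [List.map_cons, List.prod_cons, LinearEquiv.mul_apply, ← hu, refl_apply, ← sub_add, hv]
      simp [add_smul, Finset.sum_add_distrib, Pi.single_apply, ite_smul]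

theorem exists_sub_c (hB : B.IsSymm) (hsl : IsSimplyLaced B Φ) {t : Fin (n + 1)}
    {l : List (Fin (n + 1))} (hl : ∀ i ∈ l, i ≠ t) (v : V) :
    ∃ x : Fin (n + 1) → ℝ, x t = 0 ∧
      v - D.c l t v = ∑ i, x i • D.α i + B (D.α t) v • D.a := by
  have h1 : B D.a = 0 := D.a_mem_ker
  have h2 : B (D.α t) D.a = 0 := by rw [← hB.eq]; simp [h1]
  -- As a is radical, the contributions along αₜ cancel and only the shift along a survives.
  have h3 : refl B (D.α t) (refl B (D.α t + D.a) v) = v - B (D.α t) v • D.a := by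
    rw [refl_apply_of_sq_eq_two (γ := D.α t + D.a) (D.extBasis_sq hB hsl t none),
      refl_apply_of_sq_eq_two (hsl _ (D.α_mem t))]
    simp only [map_add, h1, add_zero, map_sub, map_smul, h2, smul_eq_mul, hsl _ (D.α_mem t)]
    module
  obtain ⟨x, hx, hv⟩ := D.exists_sub_prod_refl hl (v - B (D.α t) v • D.a)
  refine ⟨x, hx, ?_⟩
  rw [← hv, c, coxeterProd, LinearEquiv.mul_apply, LinearEquiv.mul_apply, h3]
  abel

/-- The translates of the roots by integral multiples of `a`. -/
def translates : Set V := {γ | ∃ δ ∈ Φ, ∃ k : ℤ, γ = δ + k • D.a}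

theorem mkQ_mem_of_mem_translates {γ : V} (hγ : γ ∈ D.translates) :
    D.U.mkQ γ ∈ D.U.mkQ '' Φ := by
  obtain ⟨δ, hδ, k, rfl⟩ := hγ
  refine ⟨δ, hδ, (Submodule.Quotient.eq D.U).2 ?_⟩
  rw [sub_add_cancel_left, neg_mem_iff]
  exact zsmul_mem D.a_mem k

theorem mem_rootLattice_of_mem_translates {γ : V} (hγ : γ ∈ D.translates) :
    γ ∈ rootLattice Φ := by
  obtain ⟨δ, hδ, k, rfl⟩ := hγ
  exact add_mem (Submodule.subset_span hδ) ((D.mem_span_a_iff _).2 ⟨k, rfl⟩).1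

theorem apply_translate (hB : B.IsSymm) (δ ε : V) (k k' : ℤ) :
    B (δ + k • D.a) (ε + k' • D.a) = B δ ε := by
  have h1 : B D.a = 0 := D.a_mem_ker
  have h2 : B δ D.a = 0 := by rw [← hB.eq]; simp [h1]
  simp [h1, h2, map_add, map_zsmul]

/-- Modulo U a translate of a root has integral coordinates in the basis βᵢ, and by `exists_sub_c`
its t-th one is 0. Subtracting the integral combination of the αᵢ leaves (αₜ|v) a in L(Φ) ∩ U = ℤa.
-/
theorem exists_int_of_sub_c_mem (hB : B.IsSymm) (hsl : IsSimplyLaced B Φ) {t : Fin (n + 1)}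
    {l : List (Fin (n + 1))} (hl : ∀ i ∈ l, i ≠ t) {v : V} (hv : v - D.c l t v ∈ D.translates) :
    (∃ k : ℤ, B (D.α t) v = k) ∧ v - D.c l t v ∈
      Submodule.span ℤ (D.α '' {t}ᶜ) ⊔ (LinearMap.ker B).restrictScalars ℤ := by
  obtain ⟨x, hx, hxv⟩ := D.exists_sub_c hB hsl hl v
  obtain ⟨z, hz, -⟩ := D.basis_aff.coeff _ (D.mkQ_mem_of_mem_translates hv)
  have hzU : v - D.c l t v - ∑ i, z i • D.α i ∈ D.U := by
    rw [← Submodule.ker_mkQ D.U, LinearMap.mem_ker, map_sub, hz, map_sum, sub_eq_zero]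
    simp only [map_zsmul]
  have hxz : x - (fun i => (z i : ℝ)) = 0 := by
    refine D.sum_smul_mem_U_iff.1 ?_
    have := sub_mem hzU (D.U.smul_mem (B (D.α t) v) D.a_mem)
    rw [hxv] at this
    convert this using 1
    simp only [Pi.sub_apply, sub_smul, Finset.sum_sub_distrib, Int.cast_smul_eq_zsmul]
    abel
  have hxz' : ∀ i, x i = z i := fun i => sub_eq_zero.1 (congrFun hxz i)
  have hsum : v - D.c l t v - ∑ i, z i • D.α i = B (D.α t) v • D.a := by
    rw [hxv]
    simp only [hxz', Int.cast_smul_eq_zsmul]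
    abel
  have hzt : z t = 0 := by
    have := hxz' t
    rw [hx] at this
    exact_mod_cast this.symm
  constructor
  · have hL : v - D.c l t v - ∑ i, z i • D.α i ∈ rootLattice Φ :=
      sub_mem (D.mem_rootLattice_of_mem_translates hv) (sum_mem fun i _ =>
        Submodule.smul_mem _ _ (Submodule.subset_span (D.α_mem i)))
    obtain ⟨k, hk⟩ := (D.mem_span_a_iff _).1 ⟨hL, hzU⟩
    rw [hsum, ← Int.cast_smul_eq_zsmul ℝ] at hk
    exact ⟨k, (smul_left_injective ℝ D.a_ne_zero hk).symm⟩
  · rw [← add_sub_cancel (∑ i, z i • D.α i) (v - D.c l t v)]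
    refine Submodule.add_mem_sup (sum_mem fun i _ => ?_) (D.U_le hzU)
    by_cases hi : i = t
    · rw [hi, hzt, zero_smul]
      exact zero_mem _
    · exact Submodule.smul_mem _ _ (Submodule.subset_span ⟨i, hi, rfl⟩)

/-- Modulo the radical, `αₜ` is not an integral combination of the other `αᵢ`, as `mₜ` does not
divide all the `mᵢ`. -/
theorem α_notMem_span [FiniteDimensional ℝ V] (hR : Module.finrank ℝ (LinearMap.ker B) = 2)
    {t j : Fin (n + 1)} (hj : D.m j < D.m t) :
    D.α t ∉ Submodule.span ℤ (D.α '' {t}ᶜ) ⊔ (LinearMap.ker B).restrictScalars ℤ := by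
  intro h
  obtain ⟨g, hg, r, hr, hgr⟩ := Submodule.mem_sup.1 h
  obtain ⟨u, hu, w, hw, huw⟩ := Submodule.mem_sup.1 (D.ker_le hR hr)
  obtain ⟨q, rfl⟩ := Submodule.mem_span_singleton.1 hw
  have hg' : ∃ z : Fin (n + 1) → ℤ, z t = 0 ∧ g = ∑ i, z i • D.α i := by
    clear hgr
    induction hg using Submodule.span_induction with
    | mem x hx =>
      obtain ⟨i, hi, rfl⟩ := hx
      exact ⟨Pi.single i 1, by simp [Ne.symm (show i ≠ t from hi)],
        by simp [Pi.single_apply, ite_smul]⟩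
    | zero => exact ⟨0, rfl, by simp⟩
    | add x y _ _ hx hy =>
      obtain ⟨z, hz, rfl⟩ := hx
      obtain ⟨z', hz', rfl⟩ := hy
      exact ⟨z + z', by simp [hz, hz'], by simp [add_smul, Finset.sum_add_distrib]⟩
    | smul k x _ hx =>
      obtain ⟨z, hz, rfl⟩ := hx
      exact ⟨k • z, by simp [hz], by simp [Finset.smul_sum, mul_smul]⟩
  obtain ⟨z, hz, rfl⟩ := hg'
  have hsum : ∑ i, ((Pi.single t 1 : Fin (n + 1) → ℝ) - (fun i => (z i : ℝ)) -
      fun i => q * D.m i) i • D.α i = u := by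
    have hb : q • D.b = ∑ i, (q * D.m i) • D.α i := by
      simp only [b, Finset.smul_sum, mul_smul, Nat.cast_smul_eq_nsmul]
    simp only [Pi.sub_apply, sub_smul, Finset.sum_sub_distrib, Int.cast_smul_eq_zsmul, ← hb]
    simp only [Pi.single_apply, ite_smul, one_smul, zero_smul, Finset.sum_ite_eq',
      Finset.mem_univ, if_true]
    rw [← hgr, ← huw]
    abel
  -- Independence modulo U allows comparing coordinates: index t gives q mₜ = 1 and index j gives zⱼ
  -- = -q mⱼ, whence mⱼ = -zⱼ mₜ.
  have h0 := D.sum_smul_mem_U_iff.1 (hsum ▸ hu)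
  have ht := congrFun h0 t
  have hj' := congrFun h0 j
  have hjt : j ≠ t := by rintro rfl; exact hj.false
  simp only [Pi.sub_apply, Pi.single_eq_same, hz, Int.cast_zero, Pi.zero_apply,
    Pi.single_eq_of_ne hjt] at ht hj'
  have h1 : (D.m j : ℝ) = (-z j * D.m t : ℝ) := by
    have : q * D.m t = 1 := by linarith
    linear_combination (-(D.m j : ℝ)) * this + (-(D.m t : ℝ)) * hj'
  have h2 : (D.m j : ℤ) = -z j * D.m t := by exact_mod_cast h1
  have h3 : (D.m t : ℤ) ∣ D.m j := ⟨-z j, by rw [h2, mul_comm]⟩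
  exact (Nat.le_of_dvd (D.m_pos j) (Int.natCast_dvd_natCast.1 h3)).not_gt hj

/-- Otherwise b = mₜ αₜ would be radical, although (b|αₜ) = 2 mₜ ≠ 0. -/
theorem exists_ne (D : EllipticBasisData B Φ n) (hsl : IsSimplyLaced B Φ) (t : Fin (n + 1)) :
    ∃ j, j ≠ t := by
  by_contra! h
  have hb : D.b = D.m t • D.α t := by
    rw [b, Finset.sum_eq_single t (fun i _ hi => (hi (h i)).elim) (by simp)]
  have h1 : B D.b = 0 := D.b_mem_ker
  have h2 : B D.b (D.α t) = D.m t * 2 := by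
    rw [hb, map_nsmul, ← hsl _ (D.α_mem t)]
    simp
  rw [h1] at h2
  have := D.m_pos t
  simp at h2
  omega

theorem c_eq_reflProd (l : List (Fin (n + 1))) (t : Fin (n + 1)) :
    D.c l t = reflProd B fun i => D.extBasis t ((extList l t).get i) := by
  rw [c, coxeterProd_eq, reflProd]
  conv_lhs => rw [← List.ofFn_get (extList l t), List.map_ofFn]
  rfl

theorem span_extBasis [FiniteDimensional ℝ V] (hV : Module.finrank ℝ V = n + 2)
    (t : Fin (n + 1)) : Submodule.span ℝ (Set.range (D.extBasis t)) = ⊤ :=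
  (D.linearIndependent_extBasis t).span_eq_top_of_card_eq_finrank' (by simp [hV])

theorem mem_ker_of_orthogonal [FiniteDimensional ℝ V] (hB : B.IsSymm)
    (hV : Module.finrank ℝ V = n + 2) (t : Fin (n + 1)) {v : V}
    (hv : ∀ o, B (D.extBasis t o) v = 0) : v ∈ LinearMap.ker B := by
  have h : Submodule.span ℝ (Set.range (D.extBasis t)) ≤ LinearMap.ker (B.flip v) := by
    rw [Submodule.span_le]
    rintro _ ⟨o, rfl⟩
    exact hv o
  rw [D.span_extBasis hV] at h
  refine LinearMap.mem_ker.2 (LinearMap.ext fun w => ?_)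
  rw [← hB.eq]
  exact h (Submodule.mem_top (x := w))

theorem mem_ker_of_c_apply_eq [FiniteDimensional ℝ V] (hB : B.IsSymm) (hsl : IsSimplyLaced B Φ)
    (hV : Module.finrank ℝ V = n + 2) {t : Fin (n + 1)} {l : List (Fin (n + 1))} (hl : l.Nodup)
    (hlt : ∀ i, i ∈ l ↔ i ≠ t) {v : V} (hv : D.c l t v = v) : v ∈ LinearMap.ker B := by
  refine D.mem_ker_of_orthogonal hB hV t fun o => ?_
  rw [c_eq_reflProd] at hv
  have h := orthogonal_of_reflProd_eq _ (fun i => D.extBasis_sq hB hsl t _)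
    ((D.linearIndependent_extBasis t).comp _ (List.nodup_iff_injective_get.1
      (nodup_extList hl hlt))) hv
  obtain ⟨i, rfl⟩ := List.mem_iff_get.1 (mem_extList hlt o)
  exact h i

theorem lt_of_reflProd_eq_c [FiniteDimensional ℝ V] (hΦ : IsEllipticRootSystem B n Φ)
    (hsl : IsSimplyLaced B Φ) (hD : D.IsTubular) {t : Fin (n + 1)} (ht : D.m t = D.mMax)
    {l : List (Fin (n + 1))} (hl : l.Nodup) (hlt : ∀ i, i ∈ l ↔ i ≠ t) {k : ℕ} {γ : Fin k → V}
    (hγ : ∀ i, γ i ∈ D.translates) (hc : D.c l t = reflProd B γ) : n < k := by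
  have hB := hΦ.signature.1
  have hR : Module.finrank ℝ (LinearMap.ker B) = 2 := hΦ.signature.2.2.2
  have hV := hΦ.finrank_eq
  obtain ⟨y, hy, hyz⟩ := exists_coeff_sub_reflProd γ (fun i => by
      obtain ⟨δ, hδ, k, hk⟩ := hγ i
      rw [hk, D.apply_translate hB, hsl δ hδ]) fun i j => by
      obtain ⟨δ, hδ, k, hk⟩ := hγ i
      obtain ⟨ε, hε, k', hk'⟩ := hγ j
      rw [hk, hk', D.apply_translate hB]
      exact hsl.exists_int hΦ.toIsRootSystemInSpan hδ hε
  have hker : LinearMap.ker (LinearMap.pi y) ≤ LinearMap.ker B := by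
    intro v hv
    have hv' : ∀ i, y i v = 0 := fun i => congrFun hv i
    refine D.mem_ker_of_c_apply_eq hB hsl hV hl hlt ?_
    have := hy v
    simp only [hv', zero_smul, Finset.sum_const_zero, sub_eq_zero] at this
    rw [hc, ← this]
  by_contra! hk
  have h1 := LinearMap.finrank_range_add_finrank_ker (LinearMap.pi y)
  have h2 := Submodule.finrank_mono hker
  -- The kernel has dimension at most 2, so the range has dimension at least n ≥ k.
  have hsurj : LinearMap.range (LinearMap.pi y) = ⊤ := by
    refine Submodule.eq_top_of_finrank_eq (le_antisymm (Submodule.finrank_le _) ?_)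
    rw [Module.finrank_fin_fun]
    omega
  choose u hu using fun i => LinearMap.range_eq_top.1 hsurj (Pi.single i 1)
  have hu' : ∀ i j, y j (u i) = (Pi.single i 1 : Fin k → ℝ) j := fun i j => congrFun (hu i) j
  have huγ : ∀ i, u i - D.c l t (u i) = γ i := by
    intro i
    rw [hc, hy]
    simp [hu', Pi.single_apply, ite_smul]
  have hint := fun i => D.exists_int_of_sub_c_mem hB hsl (fun i hi => (hlt i).1 hi)
    ((huγ i).symm ▸ hγ i)
  choose K hK using fun i => (hint i).1
  -- Subtracting ∑ yᵢ(v) uᵢ from v leaves a common zero of the yᵢ, which is radical and so killed by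
  -- (αₜ|·).
  have hα : B (D.α t) = ∑ i, K i • y i := by
    ext v
    have hv : v - ∑ i, y i v • u i ∈ LinearMap.ker (LinearMap.pi y) := by
      rw [LinearMap.mem_ker]
      ext j
      simp [map_sum, hu', Pi.single_apply]
    have hv' : B (v - ∑ i, y i v • u i) = 0 := hker hv
    have hv2 : B (D.α t) (v - ∑ i, y i v • u i) = 0 := by rw [← hB.eq, hv']; simp
    rw [map_sub, sub_eq_zero] at hv2
    simp only [hv2, map_sum, map_smul, hK, LinearMap.sum_apply, LinearMap.smul_apply, smul_eq_mul,
      zsmul_eq_mul, mul_comm]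
  have hmem : B (D.α t) ∈ (Submodule.span ℤ (Set.range γ)).map (B.restrictScalars ℤ) := by
    rw [Submodule.map_span, ← Set.range_comp, hα]
    exact sum_mem fun i _ => Submodule.smul_mem _ _ (hyz i)
  obtain ⟨g, hg, hgB⟩ := hmem
  have hgB' : B g = B (D.α t) := hgB
  obtain ⟨j, hj⟩ := D.exists_ne hsl t
  refine D.α_notMem_span hR (D.m_lt hD ht hj) ?_
  rw [← add_sub_cancel g (D.α t)]
  refine add_mem ?_ (Submodule.mem_sup_right ?_)
  · refine (Submodule.span_le.2 ?_) hg
    rintro _ ⟨i, rfl⟩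
    have := (hint i).2
    rwa [huγ] at this
  · rw [Submodule.restrictScalars_mem, LinearMap.mem_ker, map_sub, hgB', sub_self]

theorem reflLength_c [FiniteDimensional ℝ V] (hΦ : IsEllipticRootSystem B n Φ)
    (hsl : IsSimplyLaced B Φ) (hD : D.IsTubular) {t : Fin (n + 1)} (ht : D.m t = D.mMax)
    {l : List (Fin (n + 1))} (hl : l.Nodup) (hlt : ∀ i, i ∈ l ↔ i ≠ t) :
    reflLength (reflSet (weylGroup B Φ) D.S) (D.c l t) = n + 2 := by
  have hB := hΦ.signature.1
  have hext : ∀ o, D.extBasis t o ∈ D.rootBasis := fun o => D.rootBasis_eq hD ht ▸ ⟨o, rfl⟩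
  -- W fixes a, so w(αₜ + a) = wαₜ + a. Working with translates makes it unnecessary to know that αₜ
  -- + a is a root.
  have hT : ∀ x ∈ reflSet (weylGroup B Φ) D.S, ∃ γ, γ ∈ D.translates ∧ x = refl B γ := by
    rintro _ ⟨w, hw, _, ⟨δ, hδ, rfl⟩, rfl⟩
    rw [D.rootBasis_eq hD ht] at hδ
    obtain ⟨o, rfl⟩ := hδ
    refine ⟨_, ?_, conj_refl (isometry_of_mem_closure hB hw) _⟩
    cases o with
    | some i =>
      exact ⟨_, map_mem_of_mem_weylGroup hΦ.refl_mem hw _ (D.α_mem i), 0,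
        by rw [zero_smul, add_zero]; rfl⟩
    | none =>
      refine ⟨_, map_mem_of_mem_weylGroup hΦ.refl_mem hw _ (D.α_mem t), 1, ?_⟩
      rw [one_smul, extBasis, Option.elim_none, map_add, apply_eq_of_mem_ker hw hB D.a_mem_ker]
  have hT2 : ∀ x ∈ reflSet (weylGroup B Φ) D.S, ∃ γ, B γ γ = 2 ∧ x = refl B γ := by
    intro x hx
    obtain ⟨γ, ⟨δ, hδ, k, rfl⟩, rfl⟩ := hT x hx
    exact ⟨_, by rw [D.apply_translate hB, hsl δ hδ], rfl⟩
  have hlen := length_extList hl hlt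
  set L := (extList l t).map fun o => refl B (D.extBasis t o) with hL
  have hLT : ∀ x ∈ L, x ∈ reflSet (weylGroup B Φ) D.S := by
    intro x hx
    obtain ⟨o, -, rfl⟩ := List.mem_map.1 hx
    exact ⟨1, one_mem _, _, ⟨_, hext o, rfl⟩, by simp⟩
  have hLlen : L.length = n + 2 := by rw [hL, List.length_map, hlen]
  have hLc : L.prod = D.c l t := (D.coxeterProd_eq _ l t).symm
  rw [← hLlen]
  refine reflLength_eq hLT hLc fun l' hl' hc => ?_
  have hpar := length_mod_two_eq (fun x hx => hT2 x (hl' x hx)) (fun x hx => hT2 x (hLT x hx))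
    (hc.trans hLc.symm)
  obtain ⟨γ, hγ, hγc⟩ := exists_reflProd_eq fun x hx => hT x (hl' x hx)
  have := D.lt_of_reflProd_eq_c hΦ hsl hD ht hl hlt hγ (hc.symm.trans hγc)
  omega

end EllipticBasisData

/-! ### The hyperbolic cover and the length of `c̃`. -/

namespace HyperbolicExtension

variable {V : Type*} [AddCommGroup V] [Module ℝ V] {B : BilinForm ℝ V} {Φ : Set V} {n : ℕ}
  {Vh : Type*} [AddCommGroup Vh] [Module ℝ Vh] {D : EllipticBasisData B Φ n}
  {Bh : BilinForm ℝ Vh} (H : HyperbolicExtension D Bh)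

theorem incl_injective : Function.Injective H.incl := fun _ _ h =>
  H.emb_injective (congrArg Subtype.val h)

theorem restrict_incl (v w : V) : Bh.restrict H.Vt (H.incl v) (H.incl w) = B v w :=
  H.emb_isometry v w

theorem finrank_Vt [FiniteDimensional ℝ Vh] [FiniteDimensional ℝ V] :
    Module.finrank ℝ H.Vt = Module.finrank ℝ V + 1 := by
  -- b is orthogonal to all of V but not to b'.
  have hb' : H.b' ∉ LinearMap.range H.emb := by
    rintro ⟨v, hv⟩
    refine H.b_b' ?_
    rw [← hv, H.emb_isometry, LinearMap.mem_ker.1 D.b_mem_ker]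
    rfl
  have hne : H.b' ≠ 0 := fun h => hb' (h ▸ zero_mem _)
  have h := Submodule.finrank_sup_add_finrank_inf_eq (LinearMap.range H.emb)
    (Submodule.span ℝ {H.b'})
  rw [(Submodule.disjoint_span_singleton' hne).2 hb' |>.eq_bot, finrank_bot,
    finrank_span_singleton hne, LinearMap.finrank_range_of_inj H.emb_injective] at h
  exact h

theorem mem_map_ker_of_orthogonal [FiniteDimensional ℝ V] (hB : B.IsSymm)
    (hV : Module.finrank ℝ V = n + 2) (t : Fin (n + 1)) {v : H.Vt}
    (hv : ∀ o, Bh.restrict H.Vt (H.incl (D.extBasis t o)) v = 0) :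
    v ∈ (LinearMap.ker B).map H.incl := by
  have h : Submodule.span ℝ (Set.range (D.extBasis t)) ≤
      LinearMap.ker (((Bh.restrict H.Vt).flip v).comp H.incl) := by
    rw [Submodule.span_le]
    rintro _ ⟨o, rfl⟩
    exact hv o
  rw [D.span_extBasis hV] at h
  have hall : ∀ w, Bh (H.emb w) v = 0 := fun w => h (Submodule.mem_top (x := w))
  obtain ⟨x, ⟨u, rfl⟩, y, hy, hxy⟩ := Submodule.mem_sup.1 v.2
  obtain ⟨r, rfl⟩ := Submodule.mem_span_singleton.1 hy
  -- Pairing v = u + r b' with the radical vector b leaves r (b|b') = 0.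
  have hr : r = 0 := by
    have := hall D.b
    rw [← hxy, map_add, H.emb_isometry, LinearMap.mem_ker.1 D.b_mem_ker, map_smul] at this
    simpa [H.b_b'] using this
  rw [hr, zero_smul, add_zero] at hxy
  refine ⟨u, LinearMap.mem_ker.2 (LinearMap.ext fun w => ?_), Subtype.ext hxy⟩
  rw [← hB.eq, ← H.emb_isometry, hxy]
  exact hall w

theorem ct_eq_reflProd (l : List (Fin (n + 1))) (t : Fin (n + 1)) :
    H.ct l t = reflProd (Bh.restrict H.Vt)
      fun i => H.incl (D.extBasis t ((EllipticBasisData.extList l t).get i)) := by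
  rw [ct, EllipticBasisData.coxeterProd_eq, reflProd]
  conv_lhs => rw [← List.ofFn_get (EllipticBasisData.extList l t), List.map_ofFn]
  rfl

theorem mem_map_ker_of_ct_apply_eq [FiniteDimensional ℝ V] (hB : B.IsSymm)
    (hsl : IsSimplyLaced B Φ)
    (hV : Module.finrank ℝ V = n + 2) {t : Fin (n + 1)} {l : List (Fin (n + 1))} (hl : l.Nodup)
    (hlt : ∀ i, i ∈ l ↔ i ≠ t) {v : H.Vt} (hv : H.ct l t v = v) :
    v ∈ (LinearMap.ker B).map H.incl := by
  refine H.mem_map_ker_of_orthogonal hB hV t fun o => ?_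
  rw [ct_eq_reflProd] at hv
  have hli : LinearIndependent ℝ (H.incl ∘ D.extBasis t) :=
    (D.linearIndependent_extBasis t).map' H.incl (LinearMap.ker_eq_bot.2 H.incl_injective)
  have h := orthogonal_of_reflProd_eq _
    (fun i => (H.restrict_incl _ _).trans (D.extBasis_sq hB hsl t _))
    (hli.comp _ (List.nodup_iff_injective_get.1 (EllipticBasisData.nodup_extList hl hlt))) hv
  obtain ⟨i, rfl⟩ := List.mem_iff_get.1 (EllipticBasisData.mem_extList hlt o)
  exact h i

theorem reflLength_ct [FiniteDimensional ℝ V] [FiniteDimensional ℝ Vh]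
    (hΦ : IsEllipticRootSystem B n Φ)
    (hsl : IsSimplyLaced B Φ) (hD : D.IsTubular) {t : Fin (n + 1)} (ht : D.m t = D.mMax)
    {l : List (Fin (n + 1))} (hl : l.Nodup) (hlt : ∀ i, i ∈ l ↔ i ≠ t) :
    reflLength (reflSet H.Wt H.St) (H.ct l t) = n + 2 := by
  have hB := hΦ.signature.1
  have hBt : (Bh.restrict H.Vt).IsSymm := ⟨fun x y => H.signature.1.eq x y⟩
  have hR : Module.finrank ℝ (LinearMap.ker B) = 2 := hΦ.signature.2.2.2
  have hV := hΦ.finrank_eq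
  have hext : ∀ o, D.extBasis t o ∈ D.rootBasis := fun o => D.rootBasis_eq hD ht ▸ ⟨o, rfl⟩
  have hSt : H.St = refl (Bh.restrict H.Vt) '' (H.incl '' D.rootBasis) := by
    rw [Set.image_image]; rfl
  have hT : ∀ x ∈ reflSet H.Wt H.St, ∃ γ, Bh.restrict H.Vt γ γ = 2 ∧
      x = refl (Bh.restrict H.Vt) γ := by
    rintro _ ⟨w, hw, _, ⟨δ, hδ, rfl⟩, rfl⟩
    rw [D.rootBasis_eq hD ht] at hδ
    obtain ⟨o, rfl⟩ := hδ
    have hiso : ∀ u v, Bh.restrict H.Vt (w u) (w v) = Bh.restrict H.Vt u v :=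
      isometry_of_mem_closure hBt (by rwa [Wt, hSt] at hw)
    exact ⟨_, by rw [hiso, H.restrict_incl, D.extBasis_sq hB hsl], conj_refl hiso _⟩
  set L := (EllipticBasisData.extList l t).map fun o => H.reflT (D.extBasis t o) with hL
  have hLT : ∀ x ∈ L, x ∈ reflSet H.Wt H.St := by
    intro x hx
    obtain ⟨o, -, rfl⟩ := List.mem_map.1 hx
    exact ⟨1, one_mem _, _, ⟨_, hext o, rfl⟩, by simp⟩
  have hLlen : L.length = n + 2 := by
    rw [hL, List.length_map, EllipticBasisData.length_extList hl hlt]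
  have hLc : L.prod = H.ct l t := (D.coxeterProd_eq _ l t).symm
  rw [← hLlen]
  refine reflLength_eq hLT hLc fun l' hl' hc => ?_
  have hpar := length_mod_two_eq (fun x hx => hT x (hl' x hx)) (fun x hx => hT x (hLT x hx))
    (hc.trans hLc.symm)
  obtain ⟨γ, -, hγc⟩ := exists_reflProd_eq fun x hx => hT x (hl' x hx)
  -- This gives n + 3 ≤ k + 2 for a word of length k; the parity `hpar` then excludes k = n + 1.
  have h1 := le_finrank_fixed γ ((LinearMap.ker B).map H.incl) fun v hv =>
    H.mem_map_ker_of_ct_apply_eq hB hsl hV hl hlt (by rwa [← hc, hγc])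
  have h2 := Submodule.finrank_map_le H.incl (LinearMap.ker B)
  rw [H.finrank_Vt] at h1
  omega

end HyperbolicExtension

end Elliptic

end

theorem proposition1p1
    {V : Type*} [AddCommGroup V] [Module ℝ V] [FiniteDimensional ℝ V]
    {Vh : Type*} [AddCommGroup Vh] [Module ℝ Vh] [FiniteDimensional ℝ Vh]
    (n : ℕ) (B : LinearMap.BilinForm ℝ V) (Φ : Set V)
    (hΦ : Elliptic.IsEllipticRootSystem B n Φ) (hsl : Elliptic.IsSimplyLaced B Φ)
    (D : Elliptic.EllipticBasisData B Φ n) (hD : D.IsTubular)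
    (Bh : LinearMap.BilinForm ℝ Vh) (H : Elliptic.HyperbolicExtension D Bh)
    (t : Fin (n + 1)) (ht : D.m t = D.mMax)
    (l : List (Fin (n + 1))) (hl : l.Nodup) (hlt : ∀ i, i ∈ l ↔ i ≠ t) :
    Elliptic.reflLength (Elliptic.reflSet H.Wt H.St) (H.ct l t) =
        Elliptic.reflLength (Elliptic.reflSet (Elliptic.weylGroup B Φ) D.S) (D.c l t) ∧
      Elliptic.reflLength (Elliptic.reflSet (Elliptic.weylGroup B Φ) D.S) (D.c l t) =
        D.S.ncard ∧
      D.S.ncard = n + 2 := by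
  have hc := D.reflLength_c hΦ hsl hD ht hl hlt
  have hS := D.card_S hΦ.signature.1 hsl hD ht
  exact ⟨(H.reflLength_ct hΦ hsl hD ht hl hlt).trans hc.symm, hc.trans hS.symm, hS⟩
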